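/- Let $G$ be a compact Lie group, let $n\ge 0$ be an integer, and let $\sigma=(\sigma_1,\dots,\sigma_n)$ be an $n$-tuple of pairwise commuting torsion elements of $G$. Put $$C_G(\sigma)=\{g\in G : g\sigma_i=\sigma_i g \text{ for all } i\},\qquad \Lambda_G(\sigma)=\bigl(C_G(\sigma)\times\mathbb{R}^n\bigr)/\langle(\sigma_1,-e_1),\dots,(\sigma_n,-e_n)\rangle,$$ where $e_1,\dots,e_n$ is the standard basis of $\mathbb{R}^n$, let $C_G(\sigma)\to\Lambda_G(\sigma)$ be the homomorphism $g\mapsto[g,0]$, and let $\pi:\Lambda_G(\sigma)\to\mathbb{T}^n=U(1)^n$ be the homomorphism $\pi([g,t_1,\dots,t_n])=(e^{2\pi i t_1},\dots,e^{2\pi i t_n})$. For a topological group $H$ let $R(H)$ be its complex representation ring, i.e. the Grothendieck ring of finite-dimensional continuous complex representations of $H$ with respect to $\oplus$ and $\otimes$. Let $q_i\in R(\mathbb{T}^n)$ be the class of the $i$-th coordinate character $\mathbb{T}^n\to U(1)$. Then $R(\mathbb{T}^n)=\mathbb{Z}[q_1^{\pm1},\dots,q_n^{\pm1}]$, and the ring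 homomorphism $\pi^*:R(\mathbb{T}^n)\to R(\Lambda_G(\sigma))$ makes $R(\Lambda_G(\sigma))$ a free $R(\mathbb{T}^n)$-module. Moreover there is an $R(\mathbb{T}^n)$-basis of $R(\Lambda_G(\sigma))$ consisting of the classes of a set $\{V_\lambda\}$ of (isomorphism classes of) irreducible representations of $\Lambda_G(\sigma)$ such that restriction $V_\lambda\mapsto V_\lambda|_{C_G(\sigma)}$ is a bijection from $\{V_\lambda\}$ onto the set of isomorphism classes of irreducible representations of $C_G(\sigma)$. -/

import Mathlib

open scoped Manifold ContDiff

noncomputable section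

universe u v w

/-- A finite-dimensional continuous complex representation of a topological group `H`. Continuity is
expressed through matrix coefficients, which for a finite-dimensional space is the same as
continuity of `H → GL(V)`. -/
structure FDContRep (H : Type u) [Group H] [TopologicalSpace H] where
  /-- the underlying vector space -/
  V : Type
  [addCommGroup : AddCommGroup V]
  [module : Module ℂ V]
  [finiteDimensional : FiniteDimensional ℂ V]
  /-- the action -/
  ρ : Representation ℂ H V
  continuous_coeff : ∀ (x : V) (f : Module.Dual ℂ V), Continuous fun h : H => f (ρ h x)

attribute [instance] FDContRep.addCommGroup FDContRep.module FDContRep.finiteDimensional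

namespace FDContRep

variable {H : Type u} [Group H] [TopologicalSpace H]
variable {K : Type v} [Group K] [TopologicalSpace K]

/-- The direct sum `V ⊕ W`. -/
def directSum (A B : FDContRep H) : FDContRep H where
  V := A.V × B.V
  ρ := A.ρ.prod B.ρ
  continuous_coeff := by
    rintro ⟨x, y⟩ f
    have hx := A.continuous_coeff x (f ∘ₗ LinearMap.inl ℂ A.V B.V)
    have hy := B.continuous_coeff y (f ∘ₗ LinearMap.inr ℂ A.V B.V)
    refine (hx.add hy).congr fun h => ?_
    change f (A.ρ h x, 0) + f (0, B.ρ h y) = f (A.ρ h x, B.ρ h y)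
    rw [← map_add, Prod.mk_add_mk, add_zero, zero_add]

/-- The tensor product `V ⊗ W` with the diagonal action. -/
def tensor (A B : FDContRep H) : FDContRep H where
  V := TensorProduct ℂ A.V B.V
  ρ := A.ρ.tprod B.ρ
  continuous_coeff := by
    intro z f
    induction z using TensorProduct.induction_on with
    | zero => simpa using continuous_const
    | add x y hx hy =>
      refine (hx.add hy).congr fun h => ?_
      change f _ + f _ = _
      rw [← map_add, ← map_add]
    | tmul x y =>
      have key : ∀ h : H, f ((A.ρ.tprod B.ρ) h (TensorProduct.tmul ℂ x y)) =
          ∑ i, (Module.finBasis ℂ A.V).coord i (A.ρ h x) *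
            f (TensorProduct.tmul ℂ ((Module.finBasis ℂ A.V) i) (B.ρ h y)) := by
        intro h
        have e := (Module.finBasis ℂ A.V).sum_repr (A.ρ h x)
        rw [Representation.tprod_apply, TensorProduct.map_tmul]
        conv_lhs => rw [← e, TensorProduct.sum_tmul, map_sum]
        refine Finset.sum_congr rfl fun i _ => ?_
        rw [← TensorProduct.smul_tmul', map_smul, smul_eq_mul, Module.Basis.coord_apply]
      simp_rw [key]
      refine continuous_finsetSum _ fun i _ => (A.continuous_coeff x _).mul ?_
      exact B.continuous_coeff y
        (f ∘ₗ TensorProduct.mk ℂ A.V B.V ((Module.finBasis ℂ A.V) i))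

/-- The one-dimensional representation given by a continuous character `χ : H → U(1)`. -/
def ofChar (χ : H →ₜ* Circle) : FDContRep H where
  V := ℂ
  ρ :=
    { toFun := fun h => (χ h : ℂ) • LinearMap.id
      map_one' := by simp [Module.End.one_eq_id]
      map_mul' := fun a b => by ext; simp [mul_comm] }
  continuous_coeff := by
    intro x f
    have hχ : Continuous fun h : H => ((χ h : Circle) : ℂ) :=
      continuous_subtype_val.comp χ.continuous_toFun
    refine (hχ.mul (continuous_const (y := f x))).congr fun h => ?_
    change ((χ h : Circle) : ℂ) * f x = f (((χ h : Circle) : ℂ) • x)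
    rw [map_smul, smul_eq_mul]

/-- The trivial one-dimensional representation. -/
def one : FDContRep H where
  V := ℂ
  ρ := Representation.trivial ℂ H ℂ
  continuous_coeff := fun x f => by simpa using continuous_const

/-- Pullback of a representation along a continuous homomorphism. -/
def pullback (φ : H →ₜ* K) (A : FDContRep K) : FDContRep H where
  V := A.V
  ρ := A.ρ.comp (φ : H →* K)
  continuous_coeff := fun x f => (A.continuous_coeff x f).comp φ.continuous_toFun

/-- Isomorphism of representations. -/
instance setoid (H : Type u) [Group H] [TopologicalSpace H] : Setoid (FDContRep H) where
  r A B := Nonempty (A.ρ.Equiv B.ρ)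
  iseqv :=
    ⟨fun A => ⟨Representation.Equiv.refl A.ρ⟩, fun ⟨e⟩ => ⟨e.symm⟩, fun ⟨e⟩ ⟨f⟩ => ⟨e.trans f⟩⟩

end FDContRep

/-- Isomorphism classes of finite-dimensional continuous complex representations of `H`. -/
def RepClass (H : Type u) [Group H] [TopologicalSpace H] : Type (max u 1) :=
  Quotient (FDContRep.setoid H)

namespace RepClass

variable {H : Type u} [Group H] [TopologicalSpace H]
variable {K : Type v} [Group K] [TopologicalSpace K]

/-- The isomorphism class of a representation. -/
def mk (A : FDContRep H) : RepClass H := Quotient.mk _ A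

/-- Tensor product makes the isomorphism classes a commutative monoid. -/
instance : CommMonoid (RepClass H) where
  mul := Quotient.map₂ FDContRep.tensor (by
    rintro A A' ⟨e⟩ B B' ⟨f⟩
    refine ⟨Representation.Equiv.mk (TensorProduct.congr e.toLinearEquiv f.toLinearEquiv) ?_⟩
    intro g
    refine TensorProduct.ext' fun x y => ?_
    have hx := LinearMap.congr_fun (e.isIntertwining' g) x
    have hy := LinearMap.congr_fun (f.isIntertwining' g) y
    simp only [LinearMap.comp_apply] at hx hy
    exact congrArg₂ (fun a b => TensorProduct.tmul ℂ a b) hx hy)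
  one := mk FDContRep.one
  mul_assoc := by
    rintro ⟨A⟩ ⟨B⟩ ⟨C⟩
    exact Quotient.sound ⟨Representation.TensorProduct.assoc A.ρ B.ρ C.ρ⟩
  mul_comm := by
    rintro ⟨A⟩ ⟨B⟩
    exact Quotient.sound ⟨Representation.TensorProduct.comm A.ρ B.ρ⟩
  one_mul := by
    rintro ⟨A⟩
    exact Quotient.sound ⟨Representation.TensorProduct.lid ℂ A.ρ⟩
  mul_one := by
    rintro ⟨A⟩
    exact Quotient.sound ⟨Representation.TensorProduct.rid ℂ A.ρ⟩

/-- Pullback of isomorphism classes along a continuous homomorphism `H → K`; for the inclusion of a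
subgroup this is restriction. -/
def pullback (φ : H →ₜ* K) : RepClass K →* RepClass H where
  toFun := Quotient.map (FDContRep.pullback φ) (by
    rintro A B ⟨e⟩
    exact ⟨Representation.Equiv.mk e.toLinearEquiv fun g => e.isIntertwining' (φ g)⟩)
  map_one' := rfl
  map_mul' := by
    rintro ⟨A⟩ ⟨B⟩
    rfl

/-- The set of isomorphism classes of irreducible representations. -/
def irr (H : Type u) [Group H] [TopologicalSpace H] : Set (RepClass H) :=
  {c | ∃ A : FDContRep H, A.ρ.IsIrreducible ∧ mk A = c}

end RepClass

/-- The relations `[V ⊕ W] - [V] - [W]`, as an ideal of the ring which is the free abelian group on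
the isomorphism classes, with multiplication given by the tensor product. -/
def repRelations (H : Type u) [Group H] [TopologicalSpace H] :
    Ideal (MonoidAlgebra ℤ (RepClass H)) :=
  Ideal.span {x | ∃ A B : FDContRep H,
    x = MonoidAlgebra.of ℤ _ (RepClass.mk (A.directSum B)) -
      MonoidAlgebra.of ℤ _ (RepClass.mk A) - MonoidAlgebra.of ℤ _ (RepClass.mk B)}

/-- The complex representation ring `R(H)`: the free abelian group on the isomorphism classes of
finite-dimensional continuous complex representations modulo `[V ⊕ W] = [V] + [W]`, with
multiplication `[V] [W] = [V ⊗ W]`. -/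
abbrev RepRing (H : Type u) [Group H] [TopologicalSpace H] : Type (max u 1) :=
  MonoidAlgebra ℤ (RepClass H) ⧸ repRelations H

namespace RepRing

variable {H : Type u} [Group H] [TopologicalSpace H]
variable {K : Type v} [Group K] [TopologicalSpace K]

/-- The element of `R(H)` given by an isomorphism class of representations. -/
def of (c : RepClass H) : RepRing H :=
  Ideal.Quotient.mk (repRelations H) (MonoidAlgebra.of ℤ _ c)

/-- The ring homomorphism `φ^* : R(K) → R(H)`, with `φ^* [V] = [φ^* V]`. -/
def pullback (φ : H →ₜ* K) : RepRing K →+* RepRing H :=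
  Ideal.quotientMap (repRelations H)
    (MonoidAlgebra.mapDomainRingHom ℤ (RepClass.pullback φ)) (by
      refine Ideal.span_le.mpr ?_
      rintro x ⟨A, B, rfl⟩
      refine Ideal.subset_span ⟨A.pullback φ, B.pullback φ, ?_⟩
      simp only [map_sub, MonoidAlgebra.of_apply, MonoidAlgebra.mapDomainRingHom_apply,
        MonoidAlgebra.mapDomain_single]
      rfl)

theorem pullback_of (φ : H →ₜ* K) (c : RepClass K) :
    pullback φ (of c) = of (RepClass.pullback φ c) := by
  refine Ideal.quotientMap_mk.trans ?_
  rw [MonoidAlgebra.of_apply, MonoidAlgebra.mapDomainRingHom_apply, MonoidAlgebra.mapDomain_single]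
  rfl

end RepRing

/-- The torus `T^n`. -/
abbrev Torus (n : ℕ) : Type := Fin n → Circle

/-- The character `q_i : T^n → U(1)`, the projection to the `i`-th factor. -/
def torusChar {n : ℕ} (i : Fin n) : Torus n →ₜ* Circle where
  toFun z := z i
  map_one' := rfl
  map_mul' _ _ := rfl
  continuous_toFun := continuous_apply i

/-- An `n`-tuple of pairwise commuting torsion elements of `G`. -/
structure TorsionTuple (n : ℕ) (G : Type u) [Group G] where
  /-- the entries -/
  elt : Fin n → G
  commute : ∀ i j, Commute (elt i) (elt j)
  torsion : ∀ i, IsOfFinOrder (elt i)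

namespace TorsionTuple

variable {n : ℕ} {G : Type u} [Group G] (σ : TorsionTuple n G)

/-- `C_G(σ)`, the elements of `G` commuting with every `σ_i`. -/
abbrev C : Subgroup G := Subgroup.centralizer (Set.range σ.elt)

/-- `σ_i` as an element of `C_G(σ)`. -/
def eltC (i : Fin n) : σ.C :=
  ⟨σ.elt i, by rintro _ ⟨j, rfl⟩; exact (σ.commute j i).eq⟩

/-- The subgroup of `C_G(σ) × ℝ^n` generated by the elements `(σ_i, -e_i)`. The additive group
`ℝ^n` is written multiplicatively. -/
def relSubgroup : Subgroup (σ.C × Multiplicative (Fin n → ℝ)) :=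
  Subgroup.closure
    (Set.range fun i => (σ.eltC i, Multiplicative.ofAdd (-(Pi.single i 1 : Fin n → ℝ))))

instance : σ.relSubgroup.Normal := by
  refine ⟨fun x hx g => ?_⟩
  have hc : σ.relSubgroup ≤ Subgroup.center (σ.C × Multiplicative (Fin n → ℝ)) := by
    refine (Subgroup.closure_le _).mpr ?_
    rintro _ ⟨i, rfl⟩
    rw [SetLike.mem_coe, Subgroup.mem_center_iff]
    rintro ⟨a, t⟩
    refine Prod.ext (Subtype.ext ?_) (mul_comm _ _)
    exact ((Subgroup.mem_centralizer_iff.mp a.2) _ ⟨i, rfl⟩).symm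
  have := (Subgroup.mem_center_iff.mp (hc hx)) g
  rwa [this, mul_inv_cancel_right]

/-- `Λ_G(σ) = C_G(σ) × ℝ^n / ⟨(σ_1, -e_1), …, (σ_n, -e_n)⟩`, with the quotient topology when `G` is
a topological group. -/
abbrev Lam : Type u := (σ.C × Multiplicative (Fin n → ℝ)) ⧸ σ.relSubgroup

variable [TopologicalSpace G]

/-- The homomorphism `C_G(σ) → Λ_G(σ)`, `g ↦ [g, 0]`. -/
def incl : σ.C →ₜ* σ.Lam where
  toFun g := QuotientGroup.mk (g, 1)
  map_one' := rfl
  map_mul' a b := by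
    rw [← QuotientGroup.mk_mul, Prod.mk_mul_mk, mul_one]
  continuous_toFun := continuous_quotient_mk'.comp (continuous_id.prodMk continuous_const)

/-- The homomorphism `C_G(σ) × ℝ^n → T^n`, `(g, t) ↦ (e^{2πi t_1}, …, e^{2πi t_n})`. -/
def expHom : σ.C × Multiplicative (Fin n → ℝ) →* Torus n where
  toFun p j := Circle.exp (2 * Real.pi * Multiplicative.toAdd p.2 j)
  map_one' := by ext; simp
  map_mul' a b := by
    funext j
    simp [mul_add, Circle.exp_add]

/-- The homomorphism `π : Λ_G(σ) → T^n`, `[g, t] ↦ (e^{2πi t_1}, …, e^{2πi t_n})`. -/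
def π : σ.Lam →ₜ* Torus n where
  toMonoidHom := QuotientGroup.lift σ.relSubgroup σ.expHom (by
    intro x hx
    have hle : σ.relSubgroup ≤ σ.expHom.ker := by
      refine (Subgroup.closure_le _).mpr ?_
      rintro _ ⟨i, rfl⟩
      rw [SetLike.mem_coe, MonoidHom.mem_ker]
      funext j
      rcases eq_or_ne j i with rfl | h
      · simp [expHom, Circle.exp_neg]
      · simp [expHom, Pi.single_eq_of_ne h]
    exact hle hx)
  continuous_toFun := by
    refine continuous_quot_lift _ (continuous_pi fun j => ?_)
    exact Circle.exp.continuous.comp (continuous_const.mul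
      ((continuous_apply j).comp (continuous_toAdd.comp continuous_snd)))

end TorsionTuple

end

noncomputable section

universe u

namespace RepClass

variable {H : Type u} [Group H] [TopologicalSpace H]

/-! For a compact group `H` the irreducible classes form a `ℤ`-basis of `R(H)` (`irrBasis`): Haar
averaging gives complements, so they span, and by Schur's lemma the dimensions of the intertwiner
spaces `Hom(W, -)` separate them. This applies to `T^n`, whose irreducibles are the monomials `q^k`,
and to `Λ = Λ_G(σ)`, which is the image of the compact space `C_G(σ) × [0,1]^n`.

The elements `[1, t]` are central in `Λ` and together with `C = C_G(σ)` generate it, so by Schur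
they act by scalars on an irreducible. Hence irreducibles of `Λ` stay irreducible on `C`.
Conversely, if `σ_i` acts on an irreducible of `C` by `c_i`, letting `[1, t]` act by `exp(∑ t_i log
c_i)` extends it to `Λ` (`exists_extension`). Two extensions differ by a character of `ℝ^n` trivial
on `ℤ^n`, that is, by some `q^k` (`exists_twist`), and `k` is unique (`charClass_mul_injective`).

With one extension chosen for each irreducible of `C`, the map `(V, k) ↦ q^k V` is a bijection onto
the irreducibles of `Λ`. The `ℤ`-basis of `R(Λ)` thus consists of the products of the `ℤ`-basis of
`R(T^n)` with the chosen `V`, so the `V` form a basis over `R(T^n)` (`exists_basis_of_int_basis`).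
-/

theorem mk_eq_mk_iff {A B : FDContRep H} : mk A = mk B ↔ Nonempty (A.ρ.Equiv B.ρ) :=
  Quotient.eq

theorem mk_surjective : Function.Surjective (mk : FDContRep H → RepClass H) :=
  Quotient.mk_surjective

end RepClass

/-! ### Complete reducibility for compact groups. -/

namespace FDContRep

variable {H : Type u} [Group H] [TopologicalSpace H]

theorem isIrreducible_iff {H : Type*} [Monoid H] {V : Type*} [AddCommGroup V] [Module ℂ V]
    (ρ : Representation ℂ H V) :
    ρ.IsIrreducible ↔ Nontrivial V ∧ ∀ W : Submodule ℂ V,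
      (∀ g, ∀ v ∈ W, ρ g v ∈ W) → W = ⊥ ∨ W = ⊤ := by
  constructor
  · intro h
    refine ⟨?_, fun W hW => ?_⟩
    · by_contra hV
      rw [not_nontrivial_iff_subsingleton] at hV
      obtain ⟨a, b, hab⟩ := h.toNontrivial
      exact hab (Subrepresentation.toSubmodule_injective (Subsingleton.elim _ _))
    · have := h.eq_bot_or_eq_top ⟨W, fun g v hv => hW g v hv⟩
      exact this.imp (congrArg Subrepresentation.toSubmodule)
        (congrArg Subrepresentation.toSubmodule)
  · rintro ⟨hV, h⟩
    refine { exists_pair_ne := ⟨⊥, ⊤, fun e => ?_⟩, eq_bot_or_eq_top := fun W => ?_ }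
    · exact bot_ne_top (α := Submodule ℂ V) (congrArg Subrepresentation.toSubmodule e)
    · exact (h W.toSubmodule fun g v hv => W.apply_mem_toSubmodule g hv).imp
        (fun e => Subrepresentation.toSubmodule_injective e)
        (fun e => Subrepresentation.toSubmodule_injective e)

/-- A coefficient of a product of two operators expands along a basis. -/
theorem continuous_coeff_comp {X : Type*} [TopologicalSpace X] {V : Type*} [AddCommGroup V]
    [Module ℂ V] [FiniteDimensional ℂ V] {S T : X → V →ₗ[ℂ] V}
    (hS : ∀ (x : V) (f : Module.Dual ℂ V), Continuous fun h => f (S h x))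
    (hT : ∀ (x : V) (f : Module.Dual ℂ V), Continuous fun h => f (T h x))
    (x : V) (f : Module.Dual ℂ V) : Continuous fun h => f (S h (T h x)) := by
  have key : ∀ h, f (S h (T h x)) = ∑ i, (Module.finBasis ℂ V).coord i (T h x) *
      f (S h (Module.finBasis ℂ V i)) := by
    intro h
    conv_lhs => rw [← (Module.finBasis ℂ V).sum_repr (T h x), map_sum, map_sum]
    refine Finset.sum_congr rfl fun i _ => ?_
    rw [map_smul, map_smul, smul_eq_mul, Module.Basis.coord_apply]
  simp_rw [key]
  exact continuous_finsetSum _ fun i _ => (hT x _).mul (hS _ f)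

theorem ext_of_dual {V : Type*} [AddCommGroup V] [Module ℂ V] {x y : V}
    (h : ∀ f : Module.Dual ℂ V, f x = f y) : x = y := by
  rw [← sub_eq_zero, ← Module.forall_dual_apply_eq_zero_iff ℂ]
  exact fun f => by rw [map_sub, h, sub_self]

/-- Averages of operators with continuous coefficients over a compact space. -/
theorem exists_average {X : Type*} [TopologicalSpace X] [CompactSpace X] [MeasurableSpace X]
    [BorelSpace X] (μ : MeasureTheory.Measure X) [MeasureTheory.IsFiniteMeasure μ]
    {V : Type*} [AddCommGroup V] [Module ℂ V] [FiniteDimensional ℂ V] {T : X → V →ₗ[ℂ] V}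
    (hT : ∀ (x : V) (f : Module.Dual ℂ V), Continuous fun h => f (T h x)) :
    ∃ A : V →ₗ[ℂ] V, ∀ (x : V) (f : Module.Dual ℂ V), f (A x) = ∫ h, f (T h x) ∂μ := by
  have hi : ∀ (x : V) (f : Module.Dual ℂ V), MeasureTheory.Integrable (fun h => f (T h x)) μ :=
    fun x f => (hT x f).integrable_of_hasCompactSupport (HasCompactSupport.of_compactSpace _)
  let B : V →ₗ[ℂ] Module.Dual ℂ (Module.Dual ℂ V) := LinearMap.mk₂ ℂ
    (fun x f => ∫ h, f (T h x) ∂μ)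
    (fun x y f => by simp only [map_add]; exact MeasureTheory.integral_add (hi x f) (hi y f))
    (fun c x f => by simp only [map_smul]; exact MeasureTheory.integral_smul c _)
    (fun x f g => by
      simp only [LinearMap.add_apply]; exact MeasureTheory.integral_add (hi x f) (hi x g))
    (fun c x f => by simp only [LinearMap.smul_apply]; exact MeasureTheory.integral_smul c _)
  refine ⟨(Module.evalEquiv ℂ V).symm.toLinearMap ∘ₗ B, fun x f => ?_⟩
  exact Module.apply_evalEquiv_symm_apply (R := ℂ) (M := V) f (B x)

/-- Maschke's theorem for compact groups. -/
theorem exists_isCompl [IsTopologicalGroup H] [CompactSpace H] (A : FDContRep H)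
    (W : Subrepresentation A.ρ) :
    ∃ W' : Subrepresentation A.ρ, IsCompl W.toSubmodule W'.toSubmodule := by
  let : MeasurableSpace H := borel H
  have : BorelSpace H := ⟨rfl⟩
  let μ : MeasureTheory.Measure H := MeasureTheory.Measure.haarMeasure ⊤
  have : MeasureTheory.IsProbabilityMeasure μ :=
    ⟨MeasureTheory.Measure.haarMeasure_self (K₀ := (⊤ : TopologicalSpace.PositiveCompacts H))⟩
  obtain ⟨q, hq⟩ := W.toSubmodule.exists_isCompl
  let p : A.V →ₗ[ℂ] A.V := W.toSubmodule.subtype ∘ₗ W.toSubmodule.projectionOnto q hq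
  have hp : ∀ x, p x ∈ W.toSubmodule := fun x => Subtype.coe_prop _
  have hpW : ∀ x ∈ W.toSubmodule, p x = x := fun x hx => by
    exact congrArg Subtype.val (Submodule.projectionOnto_apply_left hq ⟨x, hx⟩)
  have hT : ∀ (x : A.V) (f : Module.Dual ℂ A.V),
      Continuous fun h => f ((A.ρ h ∘ₗ p ∘ₗ A.ρ h⁻¹) x) :=
    continuous_coeff_comp (S := fun h => A.ρ h) (T := fun h => p ∘ₗ A.ρ h⁻¹) A.continuous_coeff
      fun x f => (A.continuous_coeff x (f ∘ₗ p)).comp continuous_inv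
  -- `P` is the Haar average of the conjugates of the linear projection `p`. It is again a
  -- projection onto `W`, now equivariant, so its kernel is the invariant complement.
  obtain ⟨P, hP⟩ := exists_average μ hT
  have hPW : ∀ x ∈ W.toSubmodule, P x = x := fun x hx => by
    refine ext_of_dual fun f => ?_
    rw [hP]
    have : ∀ h : H, (A.ρ h ∘ₗ p ∘ₗ A.ρ h⁻¹) x = x := fun h => by
      simp [hpW _ (W.apply_mem_toSubmodule h⁻¹ hx)]
    simp [this]
  have hPm : ∀ x, P x ∈ W.toSubmodule := fun x => by
    by_contra hx
    obtain ⟨f, hf, hfW⟩ := Submodule.exists_le_ker_of_notMem hx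
    refine hf ?_
    rw [hP]
    have : ∀ h : H, f ((A.ρ h ∘ₗ p ∘ₗ A.ρ h⁻¹) x) = 0 := fun h =>
      hfW (W.apply_mem_toSubmodule h (hp _))
    simp only [this, MeasureTheory.integral_zero]
  have hPc : ∀ g x, P (A.ρ g x) = A.ρ g (P x) := fun g x => by
    refine ext_of_dual fun f => ?_
    rw [hP]
    refine Eq.trans ?_ (hP x (f ∘ₗ A.ρ g)).symm
    -- Left invariance: after replacing `h` by `g * h`, the inner `g⁻¹` cancels against `A.ρ g x`
    -- and a `g` comes out on the left.
    rw [← MeasureTheory.integral_mul_left_eq_self _ g]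
    refine MeasureTheory.integral_congr_ae (Filter.Eventually.of_forall fun h => ?_)
    simp [map_mul]
  refine ⟨⟨LinearMap.ker P, fun g v hv => ?_⟩, ?_⟩
  · rw [LinearMap.mem_ker] at hv ⊢
    rw [hPc, hv, map_zero]
  · refine ⟨Submodule.disjoint_def.mpr fun x hx hx' => ?_, codisjoint_iff.mpr ?_⟩
    · rw [← hPW x hx]; exact hx'
    · refine eq_top_iff.mpr fun x _ => Submodule.mem_sup.mpr
        ⟨P x, hPm x, x - P x, ?_, by abel⟩
      rw [LinearMap.mem_ker, map_sub, hPW _ (hPm x), sub_self]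

/-- A subrepresentation as a representation. -/
def sub (A : FDContRep H) (W : Subrepresentation A.ρ) : FDContRep H where
  V := W.toSubmodule
  ρ := W.toRepresentation
  continuous_coeff := by
    intro x f
    obtain ⟨f', hf'⟩ := f.exists_extend
    refine (A.continuous_coeff x f').congr fun h => ?_
    rw [← hf']; rfl

theorem mk_eq_of_isCompl (A : FDContRep H) (W W' : Subrepresentation A.ρ)
    (h : IsCompl W.toSubmodule W'.toSubmodule) :
    RepClass.mk A = RepClass.mk ((A.sub W).directSum (A.sub W')) := by
  refine (RepClass.mk_eq_mk_iff.mpr ⟨Representation.Equiv.mk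
    (Submodule.prodEquivOfIsCompl _ _ h) fun g => ?_⟩).symm
  refine LinearMap.ext fun x => ?_
  exact (map_add (A.ρ g) (W.toSubmodule.subtype x.1) (W'.toSubmodule.subtype x.2)).symm

end FDContRep

/-! ### The irreducible classes as a `ℤ`-basis of the representation ring. -/

namespace RepRing

variable {H : Type u} [Group H] [TopologicalSpace H]

theorem of_mul (a b : RepClass H) : of (a * b) = of a * of b := by
  rw [of, of, of, map_mul, map_mul]

theorem of_one : of (1 : RepClass H) = 1 := by
  rw [of, map_one, map_one]

/-- `of` as a monoid homomorphism. -/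
def ofHom (H : Type u) [Group H] [TopologicalSpace H] : RepClass H →* RepRing H where
  toFun := of
  map_one' := of_one
  map_mul' := of_mul

theorem of_directSum (A B : FDContRep H) :
    of (RepClass.mk (A.directSum B)) = of (RepClass.mk A) + of (RepClass.mk B) := by
  have : Ideal.Quotient.mk (repRelations H) (MonoidAlgebra.of ℤ _ (RepClass.mk (A.directSum B)) -
      MonoidAlgebra.of ℤ _ (RepClass.mk A) - MonoidAlgebra.of ℤ _ (RepClass.mk B)) = 0 :=
    Ideal.Quotient.eq_zero_iff_mem.mpr (Ideal.subset_span ⟨A, B, rfl⟩)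
  rw [map_sub, map_sub, sub_sub, sub_eq_zero] at this
  exact this

/-- A zero space is isomorphic to its own double, so its class satisfies `x = x + x`. -/
theorem of_eq_zero_of_subsingleton (A : FDContRep H) [Subsingleton A.V] :
    of (RepClass.mk A) = 0 := by
  have h : RepClass.mk A = RepClass.mk (A.directSum A) := by
    have : Subsingleton (A.directSum A).V := inferInstanceAs (Subsingleton (A.V × A.V))
    exact RepClass.mk_eq_mk_iff.mpr ⟨Representation.Equiv.mk
      { toFun := 0, invFun := 0, map_add' := by simp, map_smul' := by simp,
        left_inv := fun _ => Subsingleton.elim _ _,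
        right_inv := fun _ => Subsingleton.elim _ _ }
      fun g => LinearMap.ext fun _ => Subsingleton.elim _ _⟩
  have := of_directSum A A
  rw [← h] at this
  simpa using this

theorem span_of : Submodule.span ℤ (Set.range (of : RepClass H → RepRing H)) = ⊤ := by
  refine eq_top_iff.mpr fun x _ => ?_
  obtain ⟨x, rfl⟩ := Ideal.Quotient.mk_surjective x
  induction x using MonoidAlgebra.induction_linear with
  | zero => simp
  | add x y hx hy => rw [map_add]; exact add_mem (hx trivial) (hy trivial)
  | single c k =>
    have : (MonoidAlgebra.single c k : MonoidAlgebra ℤ (RepClass H)) =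
        k • MonoidAlgebra.of ℤ _ c := by simp
    rw [this, map_zsmul]
    exact Submodule.smul_mem _ _ (Submodule.subset_span ⟨c, rfl⟩)

/-- Induction on the dimension: a proper nonzero invariant subspace and its invariant complement
both have smaller dimension. -/
theorem of_mem_span_irr [IsTopologicalGroup H] [CompactSpace H] (A : FDContRep H) :
    of (RepClass.mk A) ∈ Submodule.span ℤ (of '' RepClass.irr H) := by
  induction h : Module.finrank ℂ A.V using Nat.strong_induction_on generalizing A with
  | _ d ih =>
    subst h
    rcases subsingleton_or_nontrivial A.V with hA | hA
    · rw [of_eq_zero_of_subsingleton]; exact zero_mem _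
    by_cases hI : A.ρ.IsIrreducible
    · exact Submodule.subset_span ⟨_, ⟨A, hI, rfl⟩, rfl⟩
    rw [FDContRep.isIrreducible_iff] at hI
    push Not at hI
    obtain ⟨W, hW, hb, ht⟩ := hI hA
    obtain ⟨W', hW'⟩ := A.exists_isCompl ⟨W, fun g v hv => hW g v hv⟩
    have hsum := Submodule.finrank_add_eq_of_isCompl hW'
    have hlt : Module.finrank ℂ W < Module.finrank ℂ A.V := Submodule.finrank_lt ht
    have hpos : 0 < Module.finrank ℂ W := Submodule.one_le_finrank_iff.mpr hb
    rw [A.mk_eq_of_isCompl _ W' hW', of_directSum]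
    refine add_mem (ih _ ?_ (A.sub _) rfl) (ih _ ?_ (A.sub _) rfl)
    · exact hlt
    · change Module.finrank ℂ W'.toSubmodule < _
      change Module.finrank ℂ W + _ = _ at hsum
      omega

theorem span_irr [IsTopologicalGroup H] [CompactSpace H] :
    Submodule.span ℤ (of '' RepClass.irr H) = ⊤ := by
  rw [← top_le_iff, ← span_of, Submodule.span_le]
  rintro _ ⟨c, rfl⟩
  obtain ⟨A, rfl⟩ := RepClass.mk_surjective c
  exact of_mem_span_irr A

/-- The relations generate an ideal, but `F` is only additive. The induction therefore proves `F (y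
* x) = 0` for all `y`. For `y` a class `[C]` this works because `C ⊗ (A ⊕ B) ≅ (C ⊗ A) ⊕ (C ⊗ B)`
turns a relation into another relation. -/
theorem eq_zero_of_mem_repRelations {M : Type*} [AddCommGroup M]
    (F : MonoidAlgebra ℤ (RepClass H) →+ M)
    (hF : ∀ A B : FDContRep H, F (MonoidAlgebra.of ℤ _ (RepClass.mk (A.directSum B))) =
      F (MonoidAlgebra.of ℤ _ (RepClass.mk A)) + F (MonoidAlgebra.of ℤ _ (RepClass.mk B)))
    {x : MonoidAlgebra ℤ (RepClass H)} (hx : x ∈ repRelations H) : F x = 0 := by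
  refine Submodule.span_induction (p := fun x _ => ∀ y, F (y * x) = 0) ?_ ?_ ?_ ?_ hx 1
    |> fun h => by simpa using h
  · rintro _ ⟨A, B, rfl⟩ y
    induction y using MonoidAlgebra.induction_linear with
    | zero => simp
    | add x y hx hy => rw [add_mul, map_add, hx, hy, add_zero]
    | single c k =>
      have hk : (MonoidAlgebra.single c k : MonoidAlgebra ℤ (RepClass H)) =
          k • MonoidAlgebra.of ℤ _ c := by simp
      obtain ⟨C, rfl⟩ := RepClass.mk_surjective c
      have hd : RepClass.mk C * RepClass.mk (A.directSum B) =
          RepClass.mk ((C.tensor A).directSum (C.tensor B)) := by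
        refine RepClass.mk_eq_mk_iff.mpr ⟨Representation.Equiv.mk
          (TensorProduct.prodRight ℂ ℂ C.V A.V B.V) fun g => ?_⟩
        refine TensorProduct.ext' fun x y => ?_
        rfl
      rw [hk, smul_mul_assoc, map_zsmul, mul_sub, mul_sub, ← map_mul, ← map_mul, ← map_mul]
      change k • F (MonoidAlgebra.of ℤ _ (RepClass.mk C * RepClass.mk (A.directSum B)) -
        MonoidAlgebra.of ℤ _ (RepClass.mk (C.tensor A)) -
        MonoidAlgebra.of ℤ _ (RepClass.mk (C.tensor B))) = 0
      rw [hd, map_sub, map_sub, hF, sub_sub, sub_self, smul_zero]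
  · simp
  · intro x y _ _ hx hy z
    rw [mul_add, map_add, hx, hy, add_zero]
  · intro a x _ hx y
    rw [smul_eq_mul, ← mul_assoc]
    exact hx _

/-- Additive maps out of the representation ring. -/
def liftAdd {M : Type*} [AddCommGroup M] (f : RepClass H → M)
    (hf : ∀ A B : FDContRep H, f (RepClass.mk (A.directSum B)) =
      f (RepClass.mk A) + f (RepClass.mk B)) : RepRing H →+ M :=
  QuotientAddGroup.lift (repRelations H).toAddSubgroup
    ((Finsupp.liftAddHom fun c => zmultiplesHom M (f c)).comp
      MonoidAlgebra.coeffAddEquiv.toAddMonoidHom)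
    fun x hx => AddMonoidHom.mem_ker.mpr <| eq_zero_of_mem_repRelations
      ((Finsupp.liftAddHom fun c => zmultiplesHom M (f c)).comp
        MonoidAlgebra.coeffAddEquiv.toAddMonoidHom) (fun A B => by simp [hf]) hx

theorem liftAdd_of {M : Type*} [AddCommGroup M] (f : RepClass H → M)
    (hf : ∀ A B : FDContRep H, f (RepClass.mk (A.directSum B)) =
      f (RepClass.mk A) + f (RepClass.mk B)) (c : RepClass H) : liftAdd f hf (of c) = f c := by
  change (Finsupp.liftAddHom fun c => zmultiplesHom M (f c)) (MonoidAlgebra.of ℤ _ c).coeff = _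
  simp

open Representation in
/-- The multiplicity of `W` in a representation, when `W` is irreducible. -/
def multiplicity (W : FDContRep H) : RepRing H →+ ℤ :=
  liftAdd (Quotient.lift (fun A => (Module.finrank ℂ (IntertwiningMap W.ρ A.ρ) : ℤ)) (by
      rintro A B ⟨e⟩
      refine congrArg Nat.cast (LinearEquiv.finrank_eq (LinearEquiv.ofLinearMap
        (IntertwiningMap.llcomp W.ρ A.ρ B.ρ e.toIntertwiningMap)
        (IntertwiningMap.llcomp W.ρ B.ρ A.ρ e.symm.toIntertwiningMap) ?_ ?_))
      · ext f x
        exact e.apply_symm_apply _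
      · ext f x
        exact e.symm_apply_apply _))
    fun A B => by
      change (Module.finrank ℂ (IntertwiningMap W.ρ (A.ρ.prod B.ρ)) : ℤ) =
        Module.finrank ℂ (IntertwiningMap W.ρ A.ρ) + Module.finrank ℂ (IntertwiningMap W.ρ B.ρ)
      let e : IntertwiningMap W.ρ (A.ρ.prod B.ρ) ≃ₗ[ℂ]
          IntertwiningMap W.ρ A.ρ × IntertwiningMap W.ρ B.ρ :=
        { toFun := fun f => ((IntertwiningMap.fst ℂ A.ρ B.ρ).comp f,
            (IntertwiningMap.snd ℂ A.ρ B.ρ).comp f)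
          invFun := fun f => IntertwiningMap.prod f.1 f.2
          map_add' := fun f g => rfl
          map_smul' := fun c f => rfl
          left_inv := fun f => rfl
          right_inv := fun f => rfl }
      rw [e.finrank_eq, Module.finrank_prod, Nat.cast_add]

theorem multiplicity_of (W A : FDContRep H) : multiplicity W (of (RepClass.mk A)) =
    Module.finrank ℂ (Representation.IntertwiningMap W.ρ A.ρ) :=
  liftAdd_of _ _ _

theorem multiplicity_of_irr {W A : FDContRep H} (hW : W.ρ.IsIrreducible)
    (hA : A.ρ.IsIrreducible) [Decidable (RepClass.mk W = RepClass.mk A)] :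
    multiplicity W (of (RepClass.mk A)) = if RepClass.mk W = RepClass.mk A then 1 else 0 := by
  split_ifs with h
  · rw [← h, multiplicity_of, Representation.IsIrreducible.finrank_intertwiningMap_self,
      Nat.cast_one]
  · rw [RepClass.mk_eq_mk_iff, not_nonempty_iff] at h
    rw [multiplicity_of, Module.finrank_zero_of_subsingleton, Nat.cast_zero]

/-- By Schur's lemma, `multiplicity W` applied to a vanishing combination of irreducibles reads off
the coefficient of `W`. -/
theorem linearIndependent_irr :
    LinearIndependent ℤ fun c : RepClass.irr H => of (c : RepClass H) := by
  classical
  rw [linearIndependent_iff]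
  intro l hl
  ext ⟨_, W, hW, rfl⟩
  have := congrArg (multiplicity W) hl
  rw [map_zero, Finsupp.linearCombination_apply, Finsupp.sum, map_sum] at this
  rw [Finsupp.zero_apply, ← this, Finset.sum_eq_single ⟨_, W, hW, rfl⟩]
  · rw [map_zsmul, multiplicity_of_irr hW hW, if_pos rfl, smul_eq_mul, mul_one]
  · rintro ⟨_, A, hA, rfl⟩ _ hne
    rw [map_zsmul, multiplicity_of_irr hW hA, if_neg, smul_zero]
    exact fun h => hne (Subtype.ext h.symm)
  · intro h
    rw [Finsupp.notMem_support_iff.mp h, zero_smul, map_zero]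

/-- The irreducible representations of a compact group form a `ℤ`-basis of its
representation ring. -/
def irrBasis (H : Type u) [Group H] [TopologicalSpace H] [IsTopologicalGroup H] [CompactSpace H] :
    Module.Basis (RepClass.irr H) ℤ (RepRing H) :=
  Module.Basis.mk linearIndependent_irr (by
    rw [top_le_iff, ← span_irr (H := H), Set.image_eq_range])

theorem irrBasis_apply [IsTopologicalGroup H] [CompactSpace H] (c : RepClass.irr H) :
    irrBasis H c = of (c : RepClass H) := by
  rw [irrBasis, Module.Basis.mk_apply]

end RepRing

/-! ### Schur's lemma and central characters. -/

namespace FDContRep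

variable {H : Type u} [Group H] [TopologicalSpace H]

theorem exists_eq_smul_of_commute {A : FDContRep H} (hA : A.ρ.IsIrreducible) (T : A.V →ₗ[ℂ] A.V)
    (hT : ∀ h, T ∘ₗ A.ρ h = A.ρ h ∘ₗ T) : ∃ c : ℂ, ∀ x, T x = c • x := by
  obtain ⟨c, hc⟩ :=
    Representation.IsIrreducible.algebraMap_intertwiningMap_bijective_of_isAlgClosed.surjective
      (⟨T, hT⟩ : Representation.IntertwiningMap A.ρ A.ρ)
  exact ⟨c, fun x => (congrArg (fun f : Representation.IntertwiningMap A.ρ A.ρ => f x) hc).symm⟩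

/-- Schur's lemma gives the scalars one at a time; a fixed nonzero vector makes them multiplicative,
and a matrix coefficient `f x ≠ 0` makes them continuous. It is used for the torus itself and for
the image of `ℝ^n` in `Λ_G(σ)`. -/
theorem exists_central_character {K : Type*} [Monoid K] [TopologicalSpace K] {A : FDContRep H}
    (hA : A.ρ.IsIrreducible) (φ : K →* H) (hφ : Continuous φ) (hc : ∀ k h, φ k * h = h * φ k) :
    ∃ χ : K →* ℂ, Continuous χ ∧ ∀ k x, A.ρ (φ k) x = χ k • x := by
  have hs : ∀ k, ∃ c : ℂ, ∀ x, A.ρ (φ k) x = c • x := fun k =>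
    exists_eq_smul_of_commute hA _ fun h => by
      rw [← Module.End.mul_eq_comp, ← Module.End.mul_eq_comp, ← map_mul, ← map_mul, hc]
  choose c h using hs
  have := ((isIrreducible_iff A.ρ).mp hA).1
  obtain ⟨x, hx⟩ := exists_ne (0 : A.V)
  obtain ⟨f, hf⟩ : ∃ f : Module.Dual ℂ A.V, f x ≠ 0 := by
    by_contra! hf
    exact hx ((Module.forall_dual_apply_eq_zero_iff ℂ x).mp hf)
  refine ⟨{ toFun := c, map_one' := ?_, map_mul' := fun k l => ?_ }, ?_, h⟩
  · refine smul_left_injective ℂ hx ?_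
    simp only [← h, map_one, one_smul, Module.End.one_apply]
  · refine smul_left_injective ℂ hx ?_
    simp only [← h, map_mul, Module.End.mul_apply, mul_smul]
  · have hk : c = fun k => f (A.ρ (φ k) x) / f x := by
      funext k
      rw [h, map_smul, smul_eq_mul, mul_div_cancel_right₀ _ hf]
    change Continuous c
    rw [hk]
    exact ((A.continuous_coeff x f).comp hφ).div_const _

end FDContRep

/-! ### Continuous characters of `ℝ`, `ℝ^n` and `T^n`. -/

open MeasureTheory intervalIntegral in
/-- Continuous characters of the line are exponentials. -/
theorem exists_eq_exp_of_continuous {χ : ℝ → ℂ} (hc : Continuous χ) (h0 : χ 0 = 1)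
    (hadd : ∀ s t, χ (s + t) = χ s * χ t) : ∃ l : ℂ, ∀ t : ℝ, χ t = Complex.exp (l * t) := by
  let F : ℝ → ℂ := fun a => ∫ t in (0 : ℝ)..a, χ t
  have hF : ∀ x, HasDerivAt F (χ x) x := fun x =>
    integral_hasDerivAt_right (hc.intervalIntegrable _ _)
      hc.stronglyMeasurable.stronglyMeasurableAtFilter hc.continuousAt
  -- Since `F' (0) = χ 0 = 1`, the primitive is not identically zero. Then `χ x * F a = F (x + a) -
  -- F x` shows that the merely continuous `χ` is differentiable.
  obtain ⟨a, ha⟩ : ∃ a, F a ≠ 0 := by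
    by_contra! h
    have := hF 0
    rw [show F = fun _ => 0 from funext h, h0] at this
    exact one_ne_zero (this.unique (hasDerivAt_const _ _))
  have hχ : ∀ x, χ x = (F (x + a) - F x) / F a := fun x => by
    rw [eq_div_iff ha]
    simp only [F]
    rw [integral_interval_sub_left (hc.intervalIntegrable _ _) (hc.intervalIntegrable _ _),
      ← intervalIntegral.integral_const_mul]
    simp_rw [← hadd]
    rw [intervalIntegral.integral_comp_add_left (fun t => χ t), add_zero]
  have hd : ∀ x, HasDerivAt χ ((χ a - 1) / F a * χ x) x := fun x => by
    have h1 := (((hF (x + a)).comp_add_const x a).sub (hF x)).div_const (F a)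
    have h2 : (χ (x + a) - χ x) / F a = (χ a - 1) / F a * χ x := by rw [hadd]; ring
    rw [h2] at h1
    exact h1.congr_of_eventuallyEq (Filter.Eventually.of_forall hχ)
  refine ⟨(χ a - 1) / F a, fun t => ?_⟩
  set l := (χ a - 1) / F a
  have he : ∀ x : ℝ, HasDerivAt (fun x : ℝ => Complex.exp (-(l * x)))
      (Complex.exp (-(l * x)) * -(l * 1)) x := fun x =>
    (((hasDerivAt_id x).ofReal_comp.const_mul l).neg).cexp
  -- `χ` solves `χ' = l χ`, so its product with `exp (-l x)` has zero derivative.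
  have hconst : ∀ x : ℝ, χ x * Complex.exp (-(l * x)) = χ 0 * Complex.exp (-(l * (0 : ℝ))) :=
    fun x => is_const_of_deriv_eq_zero (fun y => ((hd y).mul (he y)).differentiableAt)
      (fun y => by rw [((hd y).mul (he y)).deriv]; ring) x 0
  have := hconst t
  rw [h0, Complex.exp_neg, Complex.exp_neg] at this
  have hne := Complex.exp_ne_zero (l * t)
  field_simp at this
  simpa using this

theorem exists_eq_circleExp_zpow {χ : ℝ → ℂ} (hc : Continuous χ) (h0 : χ 0 = 1)
    (hadd : ∀ s t, χ (s + t) = χ s * χ t) (h1 : χ 1 = 1) :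
    ∃ k : ℤ, ∀ t : ℝ, χ t = (Circle.exp (2 * Real.pi * t) ^ k : Circle) := by
  obtain ⟨l, hl⟩ := exists_eq_exp_of_continuous hc h0 hadd
  rw [hl, Complex.exp_eq_one_iff] at h1
  obtain ⟨k, hk⟩ := h1
  refine ⟨k, fun t => ?_⟩
  rw [hl, Circle.coe_zpow, Circle.coe_exp, ← Complex.exp_int_mul]
  congr 1
  simp only [Complex.ofReal_one, mul_one] at hk
  rw [hk]
  push_cast
  ring

/-- The character `z ↦ ∏ z_i ^ k_i` of the torus. -/
def torusMonomial (n : ℕ) : Multiplicative (Fin n → ℤ) →* (Torus n →ₜ* Circle) where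
  toFun k := ∏ i, torusChar i ^ (k.toAdd i)
  map_one' := by simp
  map_mul' k l := by simp [zpow_add, Finset.prod_mul_distrib]

theorem torusMonomial_apply {n : ℕ} (k : Multiplicative (Fin n → ℤ)) (z : Torus n) :
    torusMonomial n k z = ∏ i, z i ^ (k.toAdd i) := by
  let ev : (Torus n →ₜ* Circle) →* Circle :=
    { toFun := fun f => f z, map_one' := rfl, map_mul' := fun _ _ => rfl }
  change ev (∏ i, torusChar i ^ (k.toAdd i)) = _
  rw [map_prod]
  exact Finset.prod_congr rfl fun i _ => map_zpow ev _ _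

theorem torusMonomial_single {n : ℕ} (i : Fin n) :
    torusMonomial n (Multiplicative.ofAdd (Pi.single i 1)) = torusChar i := by
  ext z
  rw [torusMonomial_apply, Finset.prod_eq_single i]
  · simp; rfl
  · intro j _ hj; simp [Pi.single_eq_of_ne hj]
  · simp

/-- The covering map `ℝ^n → T^n`. -/
def torusExp (n : ℕ) : Multiplicative (Fin n → ℝ) →* Torus n where
  toFun t j := Circle.exp (2 * Real.pi * t.toAdd j)
  map_one' := by ext; simp
  map_mul' a b := by funext j; simp [mul_add, Circle.exp_add]

theorem continuous_torusExp (n : ℕ) : Continuous (torusExp n) :=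
  continuous_pi fun j => Circle.exp.continuous.comp (continuous_const.mul
    ((continuous_apply j).comp continuous_toAdd))

theorem torusExp_surjective (n : ℕ) : Function.Surjective (torusExp n) := fun z => by
  have h : ∀ i, ∃ t : ℝ, Circle.exp (2 * Real.pi * t) = z i := fun i => by
    refine ⟨Complex.arg (z i) / (2 * Real.pi), ?_⟩
    rw [mul_div_cancel₀ _ (by positivity), Circle.exp_arg]
  choose t ht using h
  exact ⟨Multiplicative.ofAdd t, funext ht⟩

theorem torusMonomial_injective (n : ℕ) : Function.Injective (torusMonomial n) := by
  refine (injective_iff_map_eq_one _).mpr fun k hk => ?_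
  refine Multiplicative.toAdd.injective (funext fun i => ?_)
  -- The test point `e^{√-1}` has infinite order on the circle: a nonzero exponent killing it would
  -- make `π` rational.
  have h : torusMonomial n k (Pi.mulSingle i (Circle.exp 1)) = 1 := by rw [hk]; rfl
  rw [torusMonomial_apply, Finset.prod_eq_single i] at h
  · rw [Pi.mulSingle_eq_same, ← Circle.exp_zsmul, Circle.exp_eq_one] at h
    obtain ⟨m, hm⟩ := h
    by_contra hne
    change k.toAdd i ≠ 0 at hne
    rcases eq_or_ne m 0 with rfl | hm0
    · simp at hm; exact hne hm
    refine irrational_pi (?_ : _)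
    refine ⟨(k.toAdd i : ℚ) / (m * 2), ?_⟩
    have : (m : ℝ) ≠ 0 := by exact_mod_cast hm0
    push_cast
    field_simp
    simp at hm
    linarith
  · intro j _ hj; rw [Pi.mulSingle_eq_of_ne hj, one_zpow]
  · simp

/-- A continuous character of `ℝ^n` which is trivial on `ℤ^n` comes from a monomial character of
the torus. -/
theorem exists_eq_torusMonomial {n : ℕ} (χ : Multiplicative (Fin n → ℝ) →* ℂ) (hc : Continuous χ)
    (h1 : ∀ i, χ (Multiplicative.ofAdd (Pi.single i 1)) = 1) :
    ∃ k, ∀ t, χ t = (torusMonomial n k (torusExp n t) : Circle) := by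
  have h : ∀ i, ∃ k : ℤ, ∀ t : ℝ, χ (Multiplicative.ofAdd (Pi.single i t)) =
      (Circle.exp (2 * Real.pi * t) ^ k : Circle) := fun i => by
    refine exists_eq_circleExp_zpow (hc.comp (continuous_ofAdd.comp
      (continuous_single (A := fun _ => ℝ) i))) ?_ ?_ (h1 i)
    · simp
    · intro s t
      rw [← map_mul, ← ofAdd_add, Pi.single_add]
  choose k hk using h
  refine ⟨Multiplicative.ofAdd k, fun t => ?_⟩
  have ht : t = ∏ i, Multiplicative.ofAdd (Pi.single i (t.toAdd i)) := by
    rw [← ofAdd_sum, Finset.univ_sum_single]; rfl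
  conv_lhs => rw [ht]
  rw [map_prod, torusMonomial_apply]
  exact (Finset.prod_congr rfl fun i _ => hk i _).trans (map_prod Circle.coeHom
    (fun i => torusExp n t i ^ k i) Finset.univ).symm

/-! ### Twisting by characters and one-dimensional representations. -/

namespace FDContRep

variable {H : Type u} [Group H] [TopologicalSpace H]

/-- The tensor product of a representation with a character, on the same underlying space. -/
def twist (χ : H →ₜ* Circle) (A : FDContRep H) : FDContRep H where
  V := A.V
  ρ :=
    { toFun := fun h => (χ h : ℂ) • A.ρ h
      map_one' := by simp
      map_mul' := fun a b => by
        rw [map_mul, map_mul, smul_mul_smul_comm, Circle.coe_mul] }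
  continuous_coeff := by
    intro x f
    have hχ : Continuous fun h : H => ((χ h : Circle) : ℂ) :=
      continuous_subtype_val.comp χ.continuous_toFun
    refine (hχ.mul (A.continuous_coeff x f)).congr fun h => ?_
    exact (map_smul f (χ h : ℂ) (A.ρ h x)).symm

theorem mk_twist (χ : H →ₜ* Circle) (A : FDContRep H) :
    RepClass.mk (twist χ A) = RepClass.mk (ofChar χ) * RepClass.mk A := by
  refine (RepClass.mk_eq_mk_iff (A := (ofChar χ).tensor A) (B := twist χ A)).mpr
    ⟨Representation.Equiv.mk (TensorProduct.lid ℂ A.V) fun g => ?_⟩ |>.symm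
  refine TensorProduct.ext' fun (z : ℂ) x => ?_
  change ((χ g : ℂ) * z) • A.ρ g x = (χ g : ℂ) • A.ρ g (z • x)
  rw [map_smul, mul_smul]

theorem twist_isIrreducible (χ : H →ₜ* Circle) {A : FDContRep H} (hA : A.ρ.IsIrreducible) :
    (twist χ A).ρ.IsIrreducible := by
  rw [isIrreducible_iff] at hA ⊢
  refine ⟨hA.1, fun W hW => hA.2 W fun g v hv => ?_⟩
  have := W.smul_mem (χ g : ℂ)⁻¹ (hW g v hv)
  exact (inv_smul_smul₀ (Circle.coe_ne_zero (χ g)) (A.ρ g v)) ▸ this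

theorem ofChar_isIrreducible (χ : H →ₜ* Circle) : (ofChar χ).ρ.IsIrreducible := by
  rw [isIrreducible_iff]
  exact ⟨inferInstanceAs (Nontrivial ℂ), fun W _ => eq_bot_or_eq_top (α := Submodule ℂ ℂ) W⟩

/-- The isomorphism class of a one-dimensional representation, as a homomorphism. -/
def charClass (H : Type u) [Group H] [TopologicalSpace H] : (H →ₜ* Circle) →* RepClass H where
  toFun χ := RepClass.mk (ofChar χ)
  map_one' := RepClass.mk_eq_mk_iff.mpr ⟨Representation.Equiv.mk (LinearEquiv.refl ℂ ℂ) fun g =>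
    LinearMap.ext fun (z : ℂ) => by
      change ((1 : Circle) : ℂ) * z = z
      simp⟩
  map_mul' χ ψ := by
    rw [← mk_twist]
    exact RepClass.mk_eq_mk_iff.mpr ⟨Representation.Equiv.mk (LinearEquiv.refl ℂ ℂ) fun g =>
      LinearMap.ext fun (z : ℂ) => by
        change ((χ g * ψ g : Circle) : ℂ) * z = (χ g : ℂ) * ((ψ g : ℂ) * z)
        rw [Circle.coe_mul, mul_assoc]⟩

theorem charClass_injective : Function.Injective (charClass H) := fun χ ψ h => by
  obtain ⟨e⟩ := RepClass.mk_eq_mk_iff.mp h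
  ext g
  have h1 : e.toLinearEquiv ((χ g : ℂ) • (1 : ℂ)) = (ψ g : ℂ) • e.toLinearEquiv (1 : ℂ) :=
    LinearMap.congr_fun (e.isIntertwining' g) (1 : ℂ)
  have h2 : e.toLinearEquiv (1 : ℂ) ≠ 0 :=
    (LinearEquiv.map_ne_zero_iff _).mpr (one_ne_zero (α := ℂ))
  exact smul_left_injective ℂ h2 ((map_smul e.toLinearEquiv _ _).symm.trans h1)

theorem mk_eq_charClass {A : FDContRep H} (hA : A.ρ.IsIrreducible) (χ : H →ₜ* Circle)
    (h : ∀ g x, A.ρ g x = (χ g : ℂ) • x) : RepClass.mk A = charClass H χ := by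
  have hA' := (isIrreducible_iff A.ρ).mp hA
  have := hA'.1
  obtain ⟨x, hx⟩ := exists_ne (0 : A.V)
  -- The group acts by scalars, so every line is invariant and irreducibility forces dimension one.
  have hs : Submodule.span ℂ {x} = ⊤ := by
    refine (hA'.2 _ fun g v hv => ?_).resolve_left ?_
    · rw [h]; exact Submodule.smul_mem _ _ hv
    · exact fun h0 => hx (Submodule.span_singleton_eq_bot.mp h0)
  let e : ℂ ≃ₗ[ℂ] A.V := (LinearEquiv.toSpanNonzeroSingleton ℂ A.V x hx).trans
    (LinearEquiv.ofTop _ hs)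
  refine (RepClass.mk_eq_mk_iff (A := ofChar χ)).mpr ⟨Representation.Equiv.mk e fun g => ?_⟩ |>.symm
  refine LinearMap.ext fun (z : ℂ) => ?_
  exact (map_smul e (χ g : ℂ) z).trans (h g (e z)).symm

end FDContRep


/-! ### The representation ring of the torus, and bases over it. -/

open FDContRep

theorem exists_mk_eq_torusMonomial {n : ℕ} {A : FDContRep (Torus n)} (hA : A.ρ.IsIrreducible) :
    ∃ k, RepClass.mk A = charClass (Torus n) (torusMonomial n k) := by
  obtain ⟨χ, hχ, h⟩ := exists_central_character hA (MonoidHom.id (Torus n)) continuous_id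
    fun k h => mul_comm _ _
  obtain ⟨k, hk⟩ := exists_eq_torusMonomial (χ.comp (torusExp n))
    (hχ.comp (continuous_torusExp n)) fun i => by
      have : torusExp n (Multiplicative.ofAdd (Pi.single i 1)) = 1 := by
        ext j
        rcases eq_or_ne j i with rfl | hj
        · simp [torusExp]
        · simp [torusExp, Pi.single_eq_of_ne hj]
      rw [MonoidHom.comp_apply, this, map_one]
  refine ⟨k, mk_eq_charClass hA _ fun z x => ?_⟩
  obtain ⟨t, rfl⟩ := torusExp_surjective n z
  rw [← hk]
  exact h _ x

/-- The irreducible representations of the torus are the monomial characters. -/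
def torusIrrEquiv (n : ℕ) : Multiplicative (Fin n → ℤ) ≃ RepClass.irr (Torus n) :=
  Equiv.ofBijective
    (fun k => ⟨charClass (Torus n) (torusMonomial n k), _, ofChar_isIrreducible _, rfl⟩)
    ⟨fun k l h => torusMonomial_injective n (charClass_injective (congrArg Subtype.val h)), by
      rintro ⟨_, A, hA, rfl⟩
      obtain ⟨k, hk⟩ := exists_mk_eq_torusMonomial hA
      exact ⟨k, Subtype.ext hk.symm⟩⟩

/-- The monomial characters form a basis of the representation ring of the torus. -/
def torusBasis (n : ℕ) : Module.Basis (Multiplicative (Fin n → ℤ)) ℤ (RepRing (Torus n)) :=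
  (RepRing.irrBasis (Torus n)).reindex (torusIrrEquiv n).symm

theorem torusBasis_apply {n : ℕ} (k : Multiplicative (Fin n → ℤ)) :
    torusBasis n k = RepRing.of (charClass (Torus n) (torusMonomial n k)) := by
  rw [torusBasis, Module.Basis.reindex_apply, RepRing.irrBasis_apply]
  rfl

/-- The representation ring of the torus is the ring of Laurent polynomials. -/
theorem exists_ringEquiv_repRing_torus (n : ℕ) :
    ∃ e : AddMonoidAlgebra ℤ (Fin n → ℤ) ≃+* RepRing (Torus n), ∀ i,
      e (AddMonoidAlgebra.single (Pi.single i 1) 1) =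
        RepRing.of (RepClass.mk (ofChar (torusChar i))) := by
  let f : AddMonoidAlgebra ℤ (Fin n → ℤ) →ₐ[ℤ] RepRing (Torus n) :=
    AddMonoidAlgebra.lift ℤ (RepRing (Torus n)) (Fin n → ℤ)
      (((RepRing.ofHom _).comp (charClass (Torus n))).comp (torusMonomial n))
  have hf : ∀ k, f (AddMonoidAlgebra.single k 1) =
      RepRing.of (charClass (Torus n) (torusMonomial n (Multiplicative.ofAdd k))) := fun k => by
    rw [AddMonoidAlgebra.lift_single, one_smul]
    rfl
  let g : AddMonoidAlgebra ℤ (Fin n → ℤ) ≃+ RepRing (Torus n) :=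
    AddMonoidAlgebra.coeffAddEquiv.trans
      ((torusBasis n).reindex Multiplicative.toAdd).repr.symm.toAddEquiv
  -- `f` is multiplicative and `g` is bijective by comparison of bases; they agree on monomials,
  -- hence everywhere.
  have hfg : (f : AddMonoidAlgebra ℤ (Fin n → ℤ) →+ RepRing (Torus n)) = g := by
    refine AddMonoidAlgebra.addMonoidHom_ext fun k m => ?_
    have hm : (AddMonoidAlgebra.single k m : AddMonoidAlgebra ℤ (Fin n → ℤ)) =
        m • AddMonoidAlgebra.single k 1 := by simp
    rw [hm, map_zsmul, map_zsmul]
    refine congrArg (m • ·) ((hf k).trans ?_)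
    refine Eq.trans ?_ (((torusBasis n).reindex Multiplicative.toAdd).repr_symm_single_one k).symm
    rw [Module.Basis.reindex_apply, torusBasis_apply]
    rfl
  refine ⟨RingEquiv.ofBijective f ?_, fun i => ?_⟩
  · have : (f : AddMonoidAlgebra ℤ (Fin n → ℤ) → RepRing (Torus n)) = g :=
      funext fun x => DFunLike.congr_fun hfg x
    rw [this]
    exact g.bijective
  · exact (hf _).trans (by rw [torusMonomial_single]; rfl)

/-- Elements of a module whose multiples by a `ℤ`-basis of the ring form a `ℤ`-basis of the module
form a basis over the ring. -/
theorem exists_basis_of_int_basis {ι κ S R M : Type*} [CommRing R] [AddCommGroup M] [Module R M]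
    (bR : Module.Basis ι ℤ R) (bM : Module.Basis κ ℤ M) (v : S → M) (φ : (Σ _ : S, ι) ≃ κ)
    (h : ∀ s i, bM (φ ⟨s, i⟩) = bR i • v s) :
    ∃ b : Module.Basis S R M, ∀ s, b s = v s := by
  classical
  let g : (S →₀ R) ≃ₗ[ℤ] M := (Finsupp.basis fun _ : S => bR).equiv bM φ
  let f : (S →₀ R) →ₗ[R] M := Finsupp.linearCombination R v
  -- The `R`-linear `f` and the bijective `ℤ`-linear `g` agree on the `ℤ`-basis `bR i • e_s` of `S
  -- →₀ R`.
  have hfg : f.toAddMonoidHom.toIntLinearMap = g.toLinearMap := by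
    refine (Finsupp.basis fun _ : S => bR).ext fun ⟨s, i⟩ => ?_
    have h1 : g ((Finsupp.basis fun _ : S => bR) ⟨s, i⟩) = bR i • v s :=
      ((Finsupp.basis fun _ : S => bR).equiv_apply ⟨s, i⟩ bM φ).trans (h s i)
    refine Eq.trans ?_ h1.symm
    rw [Finsupp.coe_basis]
    exact Finsupp.linearCombination_single R (bR i) s
  have hb : Function.Bijective f := by
    have : (f : (S →₀ R) → M) = g := funext fun x => LinearMap.congr_fun hfg x
    rw [this]
    exact g.bijective
  refine ⟨Module.Basis.ofRepr (LinearEquiv.ofBijective f hb).symm, fun s => ?_⟩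
  rw [Module.Basis.coe_ofRepr]
  exact (Finsupp.linearCombination_single R 1 s).trans (one_smul _ _)

/-! ### Irreducible representations of `Λ_G(σ)` and their restrictions to `C_G(σ)`. -/

namespace TorsionTuple

variable {n : ℕ} {G : Type u} [Group G] (σ : TorsionTuple n G)

theorem eltC_mul_comm (i : Fin n) (g : σ.C) : σ.eltC i * g = g * σ.eltC i :=
  Subtype.ext ((Subgroup.mem_centralizer_iff.mp g.2) _ ⟨i, rfl⟩)

/-- The homomorphism `ℝ^n → Λ_G(σ)`, `t ↦ [1, t]`. -/
def line : Multiplicative (Fin n → ℝ) →* σ.Lam :=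
  (QuotientGroup.mk' σ.relSubgroup).comp (MonoidHom.inr σ.C (Multiplicative (Fin n → ℝ)))

theorem line_mul_comm (t : Multiplicative (Fin n → ℝ)) (x : σ.Lam) :
    σ.line t * x = x * σ.line t := by
  obtain ⟨⟨g, s⟩, rfl⟩ := QuotientGroup.mk_surjective x
  change QuotientGroup.mk ((1, t) * (g, s)) = QuotientGroup.mk ((g, s) * (1, t))
  simp [mul_comm]

variable [TopologicalSpace G]

theorem continuous_line : Continuous σ.line :=
  continuous_quotient_mk'.comp (continuous_const.prodMk continuous_id)

theorem exists_eq_incl_mul_line (x : σ.Lam) : ∃ g t, x = σ.incl g * σ.line t := by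
  obtain ⟨⟨g, t⟩, rfl⟩ := QuotientGroup.mk_surjective x
  refine ⟨g, t, ?_⟩
  change _ = QuotientGroup.mk ((g, 1) * (1, t))
  simp

theorem line_single (i : Fin n) :
    σ.line (Multiplicative.ofAdd (Pi.single i 1)) = σ.incl (σ.eltC i) := by
  refine QuotientGroup.eq.mpr (Subgroup.subset_closure ⟨i, ?_⟩)
  refine Prod.ext ?_ ?_
  · change σ.eltC i = 1⁻¹ * σ.eltC i
    simp
  · change _ = (Multiplicative.ofAdd (Pi.single i 1))⁻¹ * 1
    simp

theorem line_intCast_mem_range (m : Fin n → ℤ) :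
    σ.line (Multiplicative.ofAdd fun i => (m i : ℝ)) ∈ (σ.incl : σ.C →* σ.Lam).range := by
  have h : Multiplicative.ofAdd (fun i => (m i : ℝ)) =
      ∏ i, Multiplicative.ofAdd (Pi.single i 1 : Fin n → ℝ) ^ m i := by
    simp_rw [← ofAdd_zsmul]
    rw [← ofAdd_sum]
    refine congrArg _ (funext fun j => ?_)
    simp [Finset.sum_apply, Pi.single_apply]
  change _ ∈ (σ.incl : σ.C →* σ.Lam).range.comap σ.line
  rw [h]
  refine Subgroup.prod_mem _ fun i _ => Subgroup.zpow_mem _ ?_ _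
  exact ⟨σ.eltC i, (σ.line_single i).symm⟩

/-- Integer vectors of `ℝ^n` land in the image of `C_G(σ)`, so the integer part of `t` can be
absorbed into `g`, leaving `t` in the unit cube. -/
theorem compactSpace_lam [CompactSpace σ.C] : CompactSpace σ.Lam := by
  refine ⟨?_⟩
  have hc : IsCompact ((Set.univ : Set σ.C) ×ˢ (Set.Icc 0 1 : Set (Fin n → ℝ))) :=
    isCompact_univ.prod isCompact_Icc
  have hf : Continuous fun p : σ.C × (Fin n → ℝ) =>
      (QuotientGroup.mk (p.1, Multiplicative.ofAdd p.2) : σ.Lam) :=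
    continuous_quotient_mk'.comp
      (continuous_fst.prodMk (continuous_ofAdd.comp continuous_snd))
  refine (hc.image hf).of_isClosed_subset isClosed_univ fun x _ => ?_
  obtain ⟨g, t, rfl⟩ := σ.exists_eq_incl_mul_line x
  obtain ⟨c, hcm⟩ := σ.line_intCast_mem_range fun i => ⌊t.toAdd i⌋
  refine ⟨(g * c, fun i => Int.fract (t.toAdd i)),
    ⟨trivial, fun i => Int.fract_nonneg _, fun i => (Int.fract_lt_one _).le⟩, ?_⟩
  have ht : t = Multiplicative.ofAdd (fun i => (⌊t.toAdd i⌋ : ℝ)) *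
      Multiplicative.ofAdd (fun i => Int.fract (t.toAdd i)) := by
    rw [← ofAdd_add]
    exact congrArg Multiplicative.ofAdd (funext fun i => (Int.floor_add_fract _).symm)
  conv_rhs => rw [ht, map_mul, ← hcm, ← mul_assoc]
  change _ = QuotientGroup.mk ((g, 1) * (c, 1) * (1, _))
  simp

theorem π_incl (g : σ.C) : σ.π (σ.incl g) = 1 := by
  change σ.expHom (g, 1) = 1
  funext i
  simp [expHom]

theorem π_line (t : Multiplicative (Fin n → ℝ)) : σ.π (σ.line t) = torusExp n t := rfl

/-- The elements `[1, t]` act by scalars, so a subspace invariant under `C_G(σ)` is invariant under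
all of `Λ_G(σ)`. -/
theorem incl_pullback_isIrreducible {A : FDContRep σ.Lam} (hA : A.ρ.IsIrreducible) :
    (A.pullback σ.incl).ρ.IsIrreducible := by
  obtain ⟨χ, -, hχ⟩ := exists_central_character hA σ.line σ.continuous_line σ.line_mul_comm
  rw [isIrreducible_iff] at hA ⊢
  refine ⟨hA.1, fun W hW => hA.2 W fun x v hv => ?_⟩
  obtain ⟨g, t, rfl⟩ := σ.exists_eq_incl_mul_line x
  rw [map_mul, Module.End.mul_apply, hχ]
  exact hW g _ (W.smul_mem _ hv)

/-- Every irreducible representation of `C_G(σ)` extends to `Λ_G(σ)`. -/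
theorem exists_extension {B : FDContRep σ.C} (hB : B.ρ.IsIrreducible) :
    ∃ A : FDContRep σ.Lam, A.ρ.IsIrreducible ∧ A.pullback σ.incl = B := by
  have hs : ∀ i, ∃ c : ℂ, ∀ x, B.ρ (σ.eltC i) x = c • x := fun i =>
    exists_eq_smul_of_commute hB _ fun h => by
      rw [← Module.End.mul_eq_comp, ← Module.End.mul_eq_comp, ← map_mul, ← map_mul,
        σ.eltC_mul_comm]
  choose c hc using hs
  have hB' := (isIrreducible_iff B.ρ).mp hB
  have := hB'.1
  have hc0 : ∀ i, c i ≠ 0 := fun i h0 => by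
    obtain ⟨x, hx⟩ := exists_ne (0 : B.V)
    have h1 : B.ρ (σ.eltC i)⁻¹ (B.ρ (σ.eltC i) x) = x := B.ρ.inv_self_apply _ _
    rw [hc, h0, zero_smul, map_zero] at h1
    exact hx h1.symm
  -- The choice of logarithm of `c i` is immaterial here; what matters is that `μ` takes the value
  -- `c i` at `e_i`, so that `(σ_i, -e_i)` acts trivially under `τ`.
  let μ : Multiplicative (Fin n → ℝ) →* ℂ :=
    { toFun := fun t => Complex.exp (∑ i, (t.toAdd i : ℂ) * Complex.log (c i))
      map_one' := by simp
      map_mul' := fun s t => by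
        rw [← Complex.exp_add, ← Finset.sum_add_distrib]
        simp [add_mul] }
  have hμ : Continuous μ := by
    refine Complex.continuous_exp.comp (continuous_finsetSum _ fun i _ => ?_)
    exact (Complex.continuous_ofReal.comp
      ((continuous_apply i).comp continuous_toAdd)).mul continuous_const
  let τ : σ.C × Multiplicative (Fin n → ℝ) →* (B.V →ₗ[ℂ] B.V) :=
    { toFun := fun p => μ p.2 • B.ρ p.1
      map_one' := by simp
      map_mul' := fun p q => by
        rw [Prod.fst_mul, Prod.snd_mul, map_mul, map_mul, smul_mul_smul_comm] }
  have hτ : σ.relSubgroup ≤ τ.ker := by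
    refine (Subgroup.closure_le _).mpr ?_
    rintro _ ⟨i, rfl⟩
    rw [SetLike.mem_coe, MonoidHom.mem_ker]
    ext x
    change μ _ • B.ρ (σ.eltC i) x = x
    have : μ (Multiplicative.ofAdd (-(Pi.single i 1 : Fin n → ℝ))) = (c i)⁻¹ := by
      change Complex.exp (∑ j, (((-(Pi.single i 1 : Fin n → ℝ)) j : ℝ) : ℂ) * _) = _
      rw [Finset.sum_eq_single i]
      · simp [Complex.exp_neg, Complex.exp_log (hc0 i)]
      · intro j _ hj; simp [Pi.single_eq_of_ne hj]
      · simp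
    rw [this, hc, inv_smul_smul₀ (hc0 i)]
  let A : FDContRep σ.Lam :=
    { V := B.V
      ρ := QuotientGroup.lift σ.relSubgroup τ hτ
      continuous_coeff := fun x f => by
        refine continuous_coinduced_dom.mpr ?_
        refine ((hμ.comp continuous_snd).mul ((B.continuous_coeff x f).comp continuous_fst)).congr
          fun p => ?_
        exact (map_smul f (μ p.2) (B.ρ p.1 x)).symm }
  have hA : A.pullback σ.incl = B := by
    have : A.ρ.comp (σ.incl : σ.C →* σ.Lam) = B.ρ := by
      ext g x
      change μ 1 • B.ρ g x = B.ρ g x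
      rw [map_one, one_smul]
    cases B
    simp only [FDContRep.pullback]
    congr 1
  refine ⟨A, ?_, hA⟩
  rw [isIrreducible_iff]
  refine ⟨hB'.1, fun W hW => hB'.2 W fun g v hv => ?_⟩
  have := hW (σ.incl g) v hv
  change μ 1 • B.ρ g v ∈ W at this
  rwa [map_one, one_smul] at this

/-- Irreducible representations of `Λ_G(σ)` with the same restriction to `C_G(σ)` differ by a
character of the torus. -/
theorem exists_twist {A B : FDContRep σ.Lam} (hA : A.ρ.IsIrreducible) (hB : B.ρ.IsIrreducible)
    (h : RepClass.mk (A.pullback σ.incl) = RepClass.mk (B.pullback σ.incl)) :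
    ∃ k, RepClass.mk B = charClass σ.Lam ((torusMonomial n k).comp σ.π) * RepClass.mk A := by
  obtain ⟨e'⟩ := RepClass.mk_eq_mk_iff.mp h
  let e : A.V ≃ₗ[ℂ] B.V := e'.toLinearEquiv
  have he : ∀ g x, e (A.ρ (σ.incl g) x) = B.ρ (σ.incl g) (e x) := fun g x =>
    LinearMap.congr_fun (e'.isIntertwining' g) x
  obtain ⟨α, hα, hA'⟩ := exists_central_character hA σ.line σ.continuous_line σ.line_mul_comm
  obtain ⟨β, hβ, hB'⟩ := exists_central_character hB σ.line σ.continuous_line σ.line_mul_comm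
  have := ((isIrreducible_iff A.ρ).mp hA).1
  obtain ⟨x, hx⟩ := exists_ne (0 : A.V)
  have hα1 : ∀ t, α t⁻¹ * α t = 1 := fun t => by rw [← map_mul, inv_mul_cancel, map_one]
  -- The ratio of the two central characters. It is trivial at `e_i` because `[1, e_i] = [σ_i, 0]`
  -- lies in `C_G(σ)`, where the two representations agree.
  let χ : Multiplicative (Fin n → ℝ) →* ℂ :=
    { toFun := fun t => β t * α t⁻¹
      map_one' := by simp
      map_mul' := fun s t => by rw [mul_inv, map_mul, map_mul]; ring }
  obtain ⟨k, hk⟩ := exists_eq_torusMonomial χ (hβ.mul (hα.comp continuous_inv)) fun i => by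
    have h1 := he (σ.eltC i) x
    rw [← σ.line_single, hA', hB', map_smul] at h1
    have h2 := smul_left_injective ℂ ((LinearEquiv.map_ne_zero_iff e).mpr hx) h1
    change β _ * α _ = 1
    rw [← h2, mul_comm, hα1]
  refine ⟨k, ?_⟩
  change _ = RepClass.mk (ofChar _) * _
  rw [← mk_twist]
  refine (RepClass.mk_eq_mk_iff (A := twist _ A)).mpr
    ⟨Representation.Equiv.mk e fun y => ?_⟩ |>.symm
  refine LinearMap.ext fun (v : A.V) => ?_
  change e ((torusMonomial n k (σ.π y) : ℂ) • A.ρ y v) = B.ρ y (e v)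
  obtain ⟨g, t, rfl⟩ := σ.exists_eq_incl_mul_line y
  rw [map_mul, σ.π_incl, one_mul, π_line, ← hk, map_mul, map_mul, Module.End.mul_apply,
    Module.End.mul_apply, hA', hB', map_smul, map_smul, map_smul, he, smul_smul, map_smul]
  congr 1
  change β t * α t⁻¹ * α t = β t
  rw [mul_assoc, hα1, mul_one]

theorem incl_pullback_charClass (χ : Torus n →ₜ* Circle) :
    RepClass.pullback σ.incl (charClass σ.Lam (χ.comp σ.π)) = 1 := by
  rw [← map_one (charClass σ.C)]
  change charClass σ.C ((χ.comp σ.π).comp σ.incl) = _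
  congr 1
  ext g
  change ((χ (σ.π (σ.incl g)) : Circle) : ℂ) = ((1 : Circle) : ℂ)
  rw [π_incl, map_one]

/-- An isomorphism between two twists of `A` equates the scalars by which `[1, t]` acts. The central
character of `A` is nonzero and cancels, so the two monomials agree at every point of the torus. -/
theorem charClass_mul_injective {A : FDContRep σ.Lam} (hA : A.ρ.IsIrreducible) :
    Function.Injective fun k =>
      charClass σ.Lam ((torusMonomial n k).comp σ.π) * RepClass.mk A := by
  intro k l h
  obtain ⟨α, hα, hA'⟩ := exists_central_character hA σ.line σ.continuous_line σ.line_mul_comm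
  have := ((isIrreducible_iff A.ρ).mp hA).1
  obtain ⟨x, hx⟩ := exists_ne (0 : A.V)
  have hα1 : ∀ t, α t ≠ 0 := fun t h0 => by
    have : α t⁻¹ * α t = 1 := by rw [← map_mul, inv_mul_cancel, map_one]
    rw [h0, mul_zero] at this
    exact zero_ne_one this
  change RepClass.mk (ofChar _) * _ = RepClass.mk (ofChar _) * _ at h
  rw [← mk_twist, ← mk_twist] at h
  obtain ⟨e'⟩ := RepClass.mk_eq_mk_iff.mp h
  let e : A.V ≃ₗ[ℂ] A.V := e'.toLinearEquiv
  refine torusMonomial_injective n ?_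
  ext z
  obtain ⟨t, rfl⟩ := torusExp_surjective n z
  have h1 : e ((torusMonomial n k (torusExp n t) : ℂ) • A.ρ (σ.line t) x) =
      (torusMonomial n l (torusExp n t) : ℂ) • A.ρ (σ.line t) (e x) :=
    LinearMap.congr_fun (e'.isIntertwining' (σ.line t)) x
  rw [hA', hA', map_smul, map_smul] at h1
  refine smul_left_injective ℂ (smul_ne_zero (hα1 t) ((LinearEquiv.map_ne_zero_iff e).mpr hx)) h1

end TorsionTuple

end

/-! ### Assembly of the basis. -/

theorem mainTheorem3 {E : Type*} [NormedAddCommGroup E] [NormedSpace ℝ E] [FiniteDimensional ℝ E]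
    {G : Type*} [Group G] [TopologicalSpace G] [T2Space G] [CompactSpace G]
    [ChartedSpace E G] [LieGroup 𝓘(ℝ, E) ∞ G]
    {n : ℕ} (σ : TorsionTuple n G) :
    -- `R(T^n)` is the Laurent polynomial ring `ℤ[q_1^{±}, …, q_n^{±}]`
    (∃ e : AddMonoidAlgebra ℤ (Fin n → ℤ) ≃+* RepRing (Torus n),
      ∀ i, e (AddMonoidAlgebra.single (Pi.single i 1) 1) =
        RepRing.of (RepClass.mk (FDContRep.ofChar (torusChar i)))) ∧
    -- `R(Λ_G(σ))` with the module structure over `R(T^n)` given by `π^*`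
    (letI : Module (RepRing (Torus n)) (RepRing σ.Lam) := (RepRing.pullback σ.π).toModule;
      Module.Free (RepRing (Torus n)) (RepRing σ.Lam) ∧
      ∃ S : Set (RepClass σ.Lam),
        S ⊆ RepClass.irr σ.Lam ∧
        Set.BijOn (RepClass.pullback σ.incl) S (RepClass.irr σ.C) ∧
        ∃ b : Module.Basis S (RepRing (Torus n)) (RepRing σ.Lam),
          ∀ V : S, b V = RepRing.of (V : RepClass σ.Lam)) := by
  refine ⟨exists_ringEquiv_repRing_torus n, ?_⟩
  let : Module (RepRing (Torus n)) (RepRing σ.Lam) := (RepRing.pullback σ.π).toModule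
  have : IsTopologicalGroup G := topologicalGroup_of_lieGroup 𝓘(ℝ, E) ∞
  have hC : IsClosed (σ.C : Set G) := Set.isClosed_centralizer _
  have : CompactSpace σ.C := isCompact_iff_compactSpace.mp hC.isCompact
  have : CompactSpace σ.Lam := σ.compactSpace_lam
  have hext : ∀ c : RepClass.irr σ.C, ∃ d ∈ RepClass.irr σ.Lam,
      RepClass.pullback σ.incl d = c := by
    rintro ⟨_, B, hB, rfl⟩
    obtain ⟨A, hA, hAB⟩ := σ.exists_extension hB
    exact ⟨_, ⟨A, hA, rfl⟩, congrArg RepClass.mk hAB⟩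
  -- The basis is the range of `ext`: one chosen extension for each irreducible of `C_G(σ)`.
  choose ext hirr hres using hext
  have hS : Set.range ext ⊆ RepClass.irr σ.Lam := by
    rintro _ ⟨c, rfl⟩
    exact hirr c
  have hinj : Set.InjOn (RepClass.pullback σ.incl) (Set.range ext) := by
    rintro _ ⟨c, rfl⟩ _ ⟨d, rfl⟩ h
    rw [hres, hres] at h
    rw [Subtype.ext h]
  have hbij : Set.BijOn (RepClass.pullback σ.incl) (Set.range ext) (RepClass.irr σ.C) := by
    refine ⟨?_, hinj, fun c hc => ⟨ext ⟨c, hc⟩, ⟨_, rfl⟩, hres _⟩⟩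
    rintro _ ⟨c, rfl⟩
    rw [hres]
    exact c.2
  let q : Multiplicative (Fin n → ℤ) → RepClass σ.Lam := fun k =>
    FDContRep.charClass σ.Lam ((torusMonomial n k).comp σ.π)
  have hq : ∀ k, ∀ c ∈ RepClass.irr σ.Lam, q k * c ∈ RepClass.irr σ.Lam := by
    rintro k _ ⟨A, hA, rfl⟩
    exact ⟨_, FDContRep.twist_isIrreducible _ hA, FDContRep.mk_twist _ A⟩
  let φ : (Σ _ : Set.range ext, Multiplicative (Fin n → ℤ)) ≃ RepClass.irr σ.Lam :=
    Equiv.ofBijective (fun p => ⟨q p.2 * p.1, hq _ _ (hS p.1.2)⟩) (by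
      constructor
      · rintro ⟨V, k⟩ ⟨V', l⟩ h
        have h' : q k * V = q l * V' := congrArg Subtype.val h
        -- Monomials pulled back from the torus are trivial on `C_G(σ)`, so restriction forgets the
        -- twist and recovers `V`.
        have hV : V = V' := by
          have := congrArg (RepClass.pullback σ.incl) h'
          rw [map_mul, map_mul, σ.incl_pullback_charClass, σ.incl_pullback_charClass, one_mul,
            one_mul] at this
          exact Subtype.ext (hinj V.2 V'.2 this)
        subst hV
        obtain ⟨A, hA, hAV⟩ := hS V.2
        rw [← hAV] at h'
        rw [σ.charClass_mul_injective hA h']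
      · rintro ⟨_, B, hB, rfl⟩
        have hB' : RepClass.mk (B.pullback σ.incl) ∈ RepClass.irr σ.C :=
          ⟨_, σ.incl_pullback_isIrreducible hB, rfl⟩
        obtain ⟨A, hA, hAV⟩ := hirr ⟨_, hB'⟩
        have hAB : RepClass.mk (A.pullback σ.incl) = RepClass.mk (B.pullback σ.incl) :=
          (congrArg (RepClass.pullback σ.incl) hAV).trans (hres _)
        -- `A` represents the chosen extension of the restriction of `B`, so `B` is a twist of it.
        obtain ⟨k, hk⟩ := σ.exists_twist hA hB hAB
        refine ⟨⟨⟨_, ⟨_, hB'⟩, rfl⟩, k⟩, Subtype.ext ?_⟩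
        exact (hk.trans (congrArg (q k * ·) hAV)).symm)
  obtain ⟨b, hb⟩ := exists_basis_of_int_basis (torusBasis n) (RepRing.irrBasis σ.Lam)
    (fun V : Set.range ext => RepRing.of (V : RepClass σ.Lam)) φ (fun V k => by
      rw [RepRing.irrBasis_apply, torusBasis_apply]
      change RepRing.of (q k * (V : RepClass σ.Lam)) =
        RepRing.pullback σ.π (RepRing.of _) * RepRing.of (V : RepClass σ.Lam)
      rw [RepRing.of_mul, RepRing.pullback_of]
      rfl)
  exact ⟨Module.Free.of_basis b, _, hS, hbij, b, hb⟩
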